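/- **Setting.** There are $m$ base arms $[m]=\{1,\dots,m\}$, a nonempty family $\mathcal I\subseteq 2^{[m]}$ of feasible super arms, a class $\mathcal D$ of probability distributions on $[0,1]^m$, a triggering process $D^{\mathrm{trig}}$ and a reward function $R$. The unknown outcome distribution is $D\in\mathcal D$, with mean vector $\mu$. In each round $t$ the learner selects $S(t)\in\mathcal I$; an outcome vector $X(t)\sim D$ is drawn independently of the past and of $S(t)$; a set $S'(t)\supseteq S(t)$ of triggered arms is drawn from $D^{\mathrm{trig}}(S(t),X(t))$; and the learner observes $X_i(t)$ for $i\in S'(t)$ and receives the reward $R(S'(t),X(t))$. Write $p_i^{S}$ for the probability that selecting $S$ triggers arm $i$, and $\tilde S=\{i: p_i^S>0\}$. *Combinatorial Thompson Sampling (CTS)* starts with $a_i=b_i=1$ for every $i$. In each round $t$ it draws independent $\theta_i(t)\sim\mathrm{Beta}(a_i,b_i)$, selects $S(t)=\mathrm{Oracle}(\theta(t))$, and then, for each triggered arm $i$, draws $Y_i\sim\mathrm{Bernoulli}(X_i(t))$ and replaces $a_i$ by $a_i+Y_i$ and $b_i$ by $b_i+1-Y_i$. Here $\mathrm{Oracle}$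 is an exact oracle: $\mathrm{Oracle}(\theta)\in\mathrm{OPT}(\theta)=\arg\max_{S\in\mathcal I}r(S,\theta)$ for every $\theta\in[0,1]^m$, with $r$ as in (2) below. Let $\mathrm{OPT}=\mathrm{OPT}(\mu)$, let $S^*\in\mathrm{OPT}$ have $|\tilde S^*|$ minimal, and put $\tilde k^*=|\tilde S^*|$, $\Delta_S=r(S^*,\mu)-r(S,\mu)$, $\Delta_{\max}=\max_{S\in\mathcal I}\Delta_S$, $\tilde K=\max_{S\in\mathcal I}|\tilde S|$ and $\mathrm{Reg}(T)=\mathbb E\big[\sum_{t=1}^T\Delta_{S(t)}\big]$. **Theorem.** There is a universal constant $\alpha>0$ for which the following holds. Suppose that 1. the outcomes of the base arms are mutually independent under $D$, and an observed outcome has the mean of its arm: $\mathbb E[X_i\mathbb I\{i\in S'\}]=p_i^S\mu_i$ for all $i\in[m]$ and $S\in\mathcal I$, where $X\sim D$ and $S'\sim D^{\mathrm{trig}}(S,X)$ (this holds, for instance, if the triggering of an arm is independent of its own outcome); 2. there is a function $r$ such that, for every $D'\in\mathcal D$ with mean vector $\mu'$ and every $S\in\mathcal I$, the expected reward of $S$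 under $D'$ is $r(S,\mu')$; 3. $B>0$ is such that $|r(S,\theta)-r(S,\theta')|\le B\sum_{i\in\tilde S}|\theta_i-\theta_i'|$ for all $S\in\mathcal I$ and $\theta,\theta'\in[0,1]^m$; 4. $p^*>0$ and $p_i^{S}\ge p^*$ for all $i\in[m]$ and $S\in\mathcal I$. Then, for all $\rho\in(0,1)$, all $\varepsilon\in(0,1/\sqrt e]$ such that $\Delta_S>2B(\tilde k^{*2}+2)\varepsilon$ for every $S\in\mathcal I\setminus\mathrm{OPT}$, and all $T$, the regret of CTS satisfies $$\begin{aligned}\mathrm{Reg}(T)\le{}&\max\Big\{16mB\sqrt{\tfrac{e}{(1-\rho)p^*}},\ \max_{S\in\mathcal I\setminus\mathrm{OPT}}\tfrac{128mB^2|\tilde S|}{(1-\rho)p^*(\Delta_S-2B(\tilde k^{*2}+2)\varepsilon)}\log\tfrac{4B|\tilde S|}{(1-\rho)p^*(\Delta_S-2B(\tilde k^{*2}+2)\varepsilon)}\Big\}\\&+\Big(5+\tfrac{\tilde K^2}{(1-\rho)p^*\varepsilon^2}+\tfrac{2\,\mathbb I\{p^*<1\}}{\rho^2p^*}\Big)m\Delta_{\max}+\alpha\,\tfrac{8\tilde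 k^*}{p^*\varepsilon^2}\Big(\tfrac4{\varepsilon^2}+1\Big)^{\tilde k^*}\log\tfrac{\tilde k^*}{\varepsilon^2}\,\Delta_{\max}.\end{aligned}$$ (The inner maximum is omitted if $\mathcal I=\mathrm{OPT}$.) In particular the bound does not depend on $T$. -/

import Mathlib

open MeasureTheory ProbabilityTheory

noncomputable section

namespace CMAB

/-- Outcome vectors `X = (X_1, …, X_m) ∈ [0,1]^m`. -/
abbrev Outcome (m : ℕ) : Type := Fin m → unitInterval

/-- Parameter vectors lying in `[0,1]^m`. -/
def IsParam {m : ℕ} (θ : Fin m → ℝ) : Prop := ∀ i, θ i ∈ Set.Icc (0 : ℝ) 1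

/-- What the learner knows about a combinatorial bandit with probabilistically triggered arms and
`m` base arms: the feasible super arms, the class of outcome distributions, the triggering process
and the reward function. -/
structure Problem (m : ℕ) where
  /-- the set `𝓘` of feasible super arms -/
  feasible : Finset (Finset (Fin m))
  feasible_nonempty : feasible.Nonempty
  /-- the class of distributions on `[0,1]^m` that the outcome distribution belongs to -/
  distClass : Set (ProbabilityMeasure (Outcome m))
  /-- `trig (S, x)` is the law of the set of triggered arms when the super arm `S` is selected and
  the outcome vector is `x` -/
  trig : Kernel (Finset (Fin m) × Outcome m) (Finset (Fin m))
  markov_trig : IsMarkovKernel trig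
  /-- the arms of the selected super arm are themselves triggered -/
  subset_trig : ∀ S ∈ feasible, ∀ x : Outcome m, ∀ᵐ S' ∂(trig (S, x)), S ⊆ S'
  /-- the reward `R(S', x)` -/
  reward : Finset (Fin m) → Outcome m → ℝ

attribute [instance] Problem.markov_trig

/-- The mean outcome vector `μ` of an outcome distribution. -/
def meanVec {m : ℕ} (D : ProbabilityMeasure (Outcome m)) (i : Fin m) : ℝ :=
  ∫ x, (x i : ℝ) ∂(D : Measure (Outcome m))

/-- Joint law of the outcome vector and the set of triggered arms, when `S` is selected. -/
def triggerLaw {m : ℕ} (P : Problem m) (D : ProbabilityMeasure (Outcome m)) (S : Finset (Fin m)) :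
    Measure (Outcome m × Finset (Fin m)) :=
  (D : Measure (Outcome m)) ⊗ₘ (P.trig.sectR S)

/-- The triggering probability `p_i^{D,S}`. -/
def trigProb {m : ℕ} (P : Problem m) (D : ProbabilityMeasure (Outcome m)) (S : Finset (Fin m))
    (i : Fin m) : ℝ :=
  (triggerLaw P D S).real {z | i ∈ z.2}

open scoped Classical in
/-- The triggering set of a super arm: the arms that it triggers with positive probability. -/
def trigSet {m : ℕ} (P : Problem m) (D : ProbabilityMeasure (Outcome m)) (S : Finset (Fin m)) :
    Finset (Fin m) :=
  Finset.univ.filter fun i => 0 < trigProb P D S i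

/-- The outcomes of the base arms are mutually independent. -/
def IndependentOutcomes {m : ℕ} (D : ProbabilityMeasure (Outcome m)) : Prop :=
  iIndepFun (fun (i : Fin m) (x : Outcome m) => x i) (D : Measure (Outcome m))

/-- An observed outcome of a base arm has the mean of that arm: conditionally on arm `i` being
triggered by a super arm, the mean of its outcome is still `μ_i`. -/
def UnbiasedFeedback {m : ℕ} (P : Problem m) (D : ProbabilityMeasure (Outcome m)) : Prop :=
  ∀ S ∈ P.feasible, ∀ i : Fin m,
    ∫ z in {z : Outcome m × Finset (Fin m) | i ∈ z.2}, (z.1 i : ℝ) ∂(triggerLaw P D S)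
      = trigProb P D S i * meanVec D i

/-- The expected reward of a super arm `S` is `r(S, μ)`, with `μ` the mean outcome vector. -/
def IsExpectedReward {m : ℕ} (P : Problem m) (r : Finset (Fin m) → (Fin m → ℝ) → ℝ) : Prop :=
  ∀ D ∈ P.distClass, ∀ S ∈ P.feasible,
    Integrable (fun z => P.reward z.2 z.1) (triggerLaw P D S) ∧
      ∫ z, P.reward z.2 z.1 ∂(triggerLaw P D S) = r S (meanVec D)

/-- Lipschitz continuity of the expected reward in the mean outcomes of the triggering set. -/
def LipschitzReward {m : ℕ} (P : Problem m) (D : ProbabilityMeasure (Outcome m))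
    (r : Finset (Fin m) → (Fin m → ℝ) → ℝ) (B : ℝ) : Prop :=
  ∀ S ∈ P.feasible, ∀ θ θ' : Fin m → ℝ, IsParam θ → IsParam θ' →
    |r S θ - r S θ'| ≤ B * ∑ i ∈ trigSet P D S, |θ i - θ' i|

open scoped Classical in
/-- The set `OPT(θ)` of optimal super arms for the parameter vector `θ`. -/
def opt {m : ℕ} (P : Problem m) (r : Finset (Fin m) → (Fin m → ℝ) → ℝ) (θ : Fin m → ℝ) :
    Finset (Finset (Fin m)) :=
  P.feasible.filter fun S => ∀ S' ∈ P.feasible, r S' θ ≤ r S θ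

/-- The set `𝓘 - OPT` of suboptimal super arms. -/
def subopt {m : ℕ} (P : Problem m) (D : ProbabilityMeasure (Outcome m))
    (r : Finset (Fin m) → (Fin m → ℝ) → ℝ) : Finset (Finset (Fin m)) :=
  P.feasible \ opt P r (meanVec D)

/-- `Sstar` is an optimal super arm whose triggering set has minimum cardinality. -/
def IsMinimalOpt {m : ℕ} (P : Problem m) (D : ProbabilityMeasure (Outcome m))
    (r : Finset (Fin m) → (Fin m → ℝ) → ℝ) (Sstar : Finset (Fin m)) : Prop :=
  Sstar ∈ opt P r (meanVec D) ∧
    ∀ S ∈ opt P r (meanVec D), (trigSet P D Sstar).card ≤ (trigSet P D S).card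

/-- The suboptimality gap `Δ_S = r(S*, μ) - r(S, μ)`. -/
def gap {m : ℕ} (D : ProbabilityMeasure (Outcome m)) (r : Finset (Fin m) → (Fin m → ℝ) → ℝ)
    (Sstar S : Finset (Fin m)) : ℝ :=
  r Sstar (meanVec D) - r S (meanVec D)

/-- The maximum suboptimality gap `Δ_max`. -/
def gapMax {m : ℕ} (P : Problem m) (D : ProbabilityMeasure (Outcome m))
    (r : Finset (Fin m) → (Fin m → ℝ) → ℝ) (Sstar : Finset (Fin m)) : ℝ :=
  P.feasible.sup' P.feasible_nonempty fun S => gap D r Sstar S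

/-- The maximum triggering set size among all super arms. -/
def maxTrigSize {m : ℕ} (P : Problem m) (D : ProbabilityMeasure (Outcome m)) : ℕ :=
  P.feasible.sup' P.feasible_nonempty fun S => (trigSet P D S).card

/-- An exact computation oracle: it maps every parameter vector `θ` in `[0,1]^m`, measurably, to a
super arm that is optimal for `θ`. -/
structure IsOracle {m : ℕ} (P : Problem m) (r : Finset (Fin m) → (Fin m → ℝ) → ℝ)
    (oracle : (Fin m → ℝ) → Finset (Fin m)) : Prop where
  measurable : Measurable oracle
  mem_opt : ∀ θ, IsParam θ → oracle θ ∈ opt P r θ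

/-! ### Combinatorial Thompson sampling -/

/-- The record of one round: `((θ, X), (S', Y))`, where `θ` is the sample from the posterior, `X` the
outcome vector, `S'` the set of triggered arms and `Y` the binary variables used in the update of the
posterior. The selected super arm is `oracle θ`. -/
abbrev Round (m : ℕ) : Type :=
  ((Fin m → ℝ) × Outcome m) × (Finset (Fin m) × (Fin m → Bool))

/-- The state of the posterior: for each arm, how many ones and how many zeros its observations
have produced. -/
abbrev Counts (m : ℕ) : Type := Fin m → ℕ × ℕ

/-- The posterior on the mean outcome vector: independent `Beta(a_i, b_i)` laws, where `a_i` and `b_i`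
start from `1` and increase by one with each observed one and zero, respectively. -/
def posterior {m : ℕ} (c : Counts m) : Measure (Fin m → ℝ) :=
  Measure.pi fun i => betaMeasure (1 + ((c i).1 : ℝ)) (1 + ((c i).2 : ℝ))

instance {m : ℕ} (c : Counts m) : IsProbabilityMeasure (posterior c) := by
  have h : ∀ i, IsProbabilityMeasure (betaMeasure (1 + ((c i).1 : ℝ)) (1 + ((c i).2 : ℝ))) :=
    fun i => isProbabilityMeasureBeta (by positivity) (by positivity)
  unfold posterior
  infer_instance

/-- Given the outcome vector `x`, the variables `Y_i` are independent, `Y_i` being `1` (`true`) with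
probability `x_i` and `0` (`false`) with probability `1 - x_i`. -/
def flips (m : ℕ) : Kernel (Outcome m) (Fin m → Bool) where
  toFun x := Measure.pi fun i => bernoulliMeasure true false (x i)
  measurable' := by
    refine Measure.measurable_of_measurable_coe _ fun s _ => ?_
    have key : ∀ x : Outcome m,
        (Measure.pi fun i => bernoulliMeasure true false (x i)) s
          = ∑ y ∈ s.toFinite.toFinset, ∏ i, (bernoulliMeasure true false (x i)) {y i} := by
      intro x
      have h : ((s.toFinite.toFinset : Finset (Fin m → Bool)) : Set (Fin m → Bool)) = s :=
        s.toFinite.coe_toFinset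
      conv_lhs => rw [← h, ← sum_measure_singleton]
      simp only [Measure.pi_singleton]
    simp only [key]
    refine Finset.measurable_sum _ fun y _ => Finset.measurable_prod _ fun i _ => ?_
    have hx : Measurable fun x : Outcome m => ((x i : unitInterval) : ℝ) :=
      measurable_subtype_coe.comp (measurable_pi_apply i)
    have h1 : Measurable fun x : Outcome m => ENNReal.ofReal ((x i : unitInterval) : ℝ) :=
      hx.ennreal_ofReal
    have h2 : Measurable fun x : Outcome m => ENNReal.ofReal (1 - ((x i : unitInterval) : ℝ)) :=
      (measurable_const.sub hx).ennreal_ofReal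
    have e1 : ∀ p : unitInterval,
        (bernoulliMeasure true false p) {true} = ENNReal.ofReal (p : ℝ) := by
      intro p
      rw [bernoulliMeasure_def, Measure.add_apply, Measure.smul_apply, Measure.smul_apply,
        Measure.dirac_apply, Measure.dirac_apply, Set.indicator_of_mem (by simp),
        Set.indicator_of_notMem (by simp), Pi.one_apply, smul_zero, add_zero, ENNReal.smul_def,
        smul_eq_mul, mul_one, ENNReal.ofReal, Real.toNNReal_of_nonneg p.2.1]
      rfl
    have e2 : ∀ p : unitInterval,
        (bernoulliMeasure true false p) {false} = ENNReal.ofReal (1 - (p : ℝ)) := by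
      intro p
      rw [bernoulliMeasure_def, Measure.add_apply, Measure.smul_apply, Measure.smul_apply,
        Measure.dirac_apply, Measure.dirac_apply, Set.indicator_of_notMem (by simp),
        Set.indicator_of_mem (by simp), Pi.one_apply, smul_zero, zero_add, ENNReal.smul_def,
        smul_eq_mul, mul_one, ENNReal.ofReal, Real.toNNReal_of_nonneg (sub_nonneg.2 p.2.2)]
      rfl
    cases hy : y i
    · simp only [e2]
      exact h2
    · simp only [e1]
      exact h1

instance (m : ℕ) : IsMarkovKernel (flips m) :=
  ⟨fun x => inferInstanceAs
    (IsProbabilityMeasure (Measure.pi fun i => bernoulliMeasure true false (x i)))⟩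

/-- The law of a round that starts with the posterior given by `c`: independently `θ` is drawn from
the posterior and `X` from `D`; given `(θ, X)`, independently `S'` is drawn from the triggering
process for the super arm `oracle θ` and `Y_i` from the Bernoulli law with mean `X_i`. -/
def roundLaw {m : ℕ} (P : Problem m) (D : ProbabilityMeasure (Outcome m))
    {oracle : (Fin m → ℝ) → Finset (Fin m)} (ho : Measurable oracle) (c : Counts m) :
    Measure (Round m) :=
  ((posterior c).prod (D : Measure (Outcome m))) ⊗ₘ
    ((P.trig.comap (fun z : (Fin m → ℝ) × Outcome m => (oracle z.1, z.2))
        ((ho.comp measurable_fst).prodMk measurable_snd)) ×ₖ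
      ((flips m).comap Prod.snd measurable_snd))

instance {m : ℕ} (P : Problem m) (D : ProbabilityMeasure (Outcome m))
    {oracle : (Fin m → ℝ) → Finset (Fin m)} (ho : Measurable oracle) (c : Counts m) :
    IsProbabilityMeasure (roundLaw P D ho c) := by
  unfold roundLaw
  infer_instance

open scoped Classical in
/-- The posterior state after the first `n + 1` rounds: only triggered arms are updated, a `Y_i = 1`
increasing the first count of arm `i` and a `Y_i = 0` the second. -/
def counts {m : ℕ} (n : ℕ) (h : (k : Finset.Iic n) → Round m) : Counts m := fun i =>
  ((Finset.univ.filter fun k => i ∈ (h k).2.1 ∧ (h k).2.2 i = true).card,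
    (Finset.univ.filter fun k => i ∈ (h k).2.1 ∧ (h k).2.2 i = false).card)

lemma measurable_counts {m : ℕ} (n : ℕ) : Measurable (counts (m := m) n) := by
  classical
  have hm : ∀ (i : Fin m) (b : Bool), MeasurableSet {x : Round m | i ∈ x.2.1 ∧ x.2.2 i = b} := by
    intro i b
    refine MeasurableSet.inter ?_ ?_
    · exact (measurableSet_mem_finset i).preimage (measurable_fst.comp measurable_snd)
    · exact (measurableSet_singleton b).preimage
        ((measurable_pi_apply i).comp (measurable_snd.comp measurable_snd))
  have hc : ∀ (i : Fin m) (b : Bool), Measurable fun h : (k : Finset.Iic n) → Round m =>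
      (Finset.univ.filter fun k => i ∈ (h k).2.1 ∧ (h k).2.2 i = b).card := by
    intro i b
    simp only [Finset.card_filter]
    refine Finset.measurable_sum _ fun k _ => ?_
    exact Measurable.ite ((hm i b).preimage (measurable_pi_apply k)) measurable_const
      measurable_const
  refine measurable_pi_lambda _ fun i => ?_
  exact (hc i true).prodMk (hc i false)

/-- The conditional law of the next round given the rounds `0, …, n`. -/
def stepKernel {m : ℕ} (P : Problem m) (D : ProbabilityMeasure (Outcome m))
    {oracle : (Fin m → ℝ) → Finset (Fin m)} (ho : Measurable oracle) (n : ℕ) :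
    Kernel ((k : Finset.Iic n) → Round m) (Round m) where
  toFun h := roundLaw P D ho (counts n h)
  measurable' := (Measurable.of_discrete (f := roundLaw P D ho)).comp (measurable_counts n)

instance {m : ℕ} (P : Problem m) (D : ProbabilityMeasure (Outcome m))
    {oracle : (Fin m → ℝ) → Finset (Fin m)} (ho : Measurable oracle) (n : ℕ) :
    IsMarkovKernel (stepKernel P D ho n) :=
  ⟨fun h => inferInstanceAs (IsProbabilityMeasure (roundLaw P D ho (counts n h)))⟩

/-- The law of the sequence of all rounds (numbered from `0`) of combinatorial Thompson sampling. -/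
def ctsLaw {m : ℕ} (P : Problem m) (D : ProbabilityMeasure (Outcome m))
    {oracle : (Fin m → ℝ) → Finset (Fin m)} (ho : Measurable oracle) : Measure (ℕ → Round m) :=
  Kernel.trajMeasure (X := fun _ => Round m) (roundLaw P D ho 0) (stepKernel P D ho)

/-- The regret of combinatorial Thompson sampling by round `T`:
`Reg(T) = 𝔼[∑_{t = 1}^T (r(S*, μ) - r(S(t), μ))]`. -/
def regret {m : ℕ} (P : Problem m) (D : ProbabilityMeasure (Outcome m))
    (r : Finset (Fin m) → (Fin m → ℝ) → ℝ) {oracle : (Fin m → ℝ) → Finset (Fin m)}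
    (ho : Measurable oracle) (Sstar : Finset (Fin m)) (T : ℕ) : ℝ :=
  ∫ ω, ∑ t ∈ Finset.range T,
    (r Sstar (meanVec D) - r (oracle (ω t).1.1) (meanVec D)) ∂(ctsLaw P D ho)

end CMAB

end

/-! Since every super arm triggers every arm with probability at least `p`, each arm is explored at
a linear rate whatever is played, and the posterior concentrates geometrically fast. The triggering
sets are all of `[m]`, so `k = m`, and the gap hypothesis exceeds `2 * B * m * ε`. If all
coordinates of a sample are within `ε` of the means, the Lipschitz condition bounds the gap of the
selected arm by `2 * B * m * ε`, hence that arm is optimal. The regret is therefore at most the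
maximum gap times the expected number of pairs (round, arm) whose sample deviates by more than `ε`
(`regret_le_sum_deviation`).

Each deviation probability is handled by one exponential weight, without separating the error of the
empirical mean from that of the posterior. A tail of Beta(1 + a, 1 + b) is at most `w ^ (a + b + 2)
/ s ^ (a + 1)` (`betaMeasure_tail_le`). This bound is multiplicative in the observations: a one
contributes `w / s`, a zero contributes `w`. By unbiased feedback the expected factor of an
observation is `μ * (w / s) + (1 - μ) * w`, at most `1 - ε ^ 2 / 4` for suitable `s` and `w`. So the
expected weight shrinks by `1 - p * ε ^ 2 / 4` per round (`lintegral_tailWeight_le`).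

Summing the geometric series over rounds and arms gives regret at most `16 * m / (p * ε ^ 2)` times
the maximum gap (`regret_le_mul_gapMax`). The last term of the claimed bound alone dominates this;
the other terms are nonnegative. -/

open MeasureTheory ProbabilityTheory

namespace CMAB

open scoped ENNReal

/-! ### Chernoff bounds for Beta distributions -/

section Tail

/-- The Chernoff weight of `a` ones and `b` zeros, at the tilting parameters `s` and `w`. -/
noncomputable def tailWeight (s w : ℝ) (c : ℕ × ℕ) : ℝ≥0∞ :=
  ENNReal.ofReal (w ^ (c.1 + c.2 + 2) / s ^ (c.1 + 1))

/-- Chernoff bound for the Beta distribution, by the change of variables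
`x ↦ s * x / (1 - x + s * x)` of the unit interval. -/
lemma betaMeasure_tail_le {s w : ℝ} (hs : 0 < s) (hw : 0 < w) (a b : ℕ) :
    betaMeasure (1 + (a : ℝ)) (1 + (b : ℝ)) {x | 1 - x + s * x ≤ w} ≤ tailWeight s w (a, b) := by
  have ha : (0 : ℝ) < 1 + a := by positivity
  have hb : (0 : ℝ) < 1 + b := by positivity
  set A : Set ℝ := {x | 1 - x + s * x ≤ w} with hA
  have hAm : MeasurableSet A := measurableSet_le (by fun_prop) (by fun_prop)
  -- The density vanishes off the open unit interval; inside it the denominator of the substitution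
  -- is positive.
  set E : Set ℝ := A ∩ Set.Ioo 0 1 with hE
  have hEm : MeasurableSet E := hAm.inter measurableSet_Ioo
  have hd : ∀ x ∈ E, 0 < 1 - x + s * x := fun x hx => by
    have := mul_pos hs hx.2.1
    linarith [hx.2.2]
  set φ : ℝ → ℝ := fun x => s * x / (1 - x + s * x) with hφ
  have hφ' : ∀ x ∈ E, HasDerivWithinAt φ (s / (1 - x + s * x) ^ 2) E x := fun x hx => by
    have h1 : HasDerivAt (fun x : ℝ => s * x) s x := by
      simpa using (hasDerivAt_id x).const_mul s
    have h2 : HasDerivAt (fun x : ℝ => 1 - x + s * x) (-1 + s) x := by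
      exact ((hasDerivAt_id x).const_sub 1).add h1
    refine (HasDerivAt.congr_deriv (h1.div h2 (hd x hx).ne') ?_).hasDerivWithinAt
    congr 1
    ring
  have hinj : Set.InjOn φ E := fun x hx y hy hxy => by
    have h := (div_eq_div_iff (hd x hx).ne' (hd y hy).ne').1 hxy
    have : s * (x - y) = 0 := by linarith
    rcases mul_eq_zero.1 this with h | h
    · exact absurd h hs.ne'
    · linarith
  have hpt : ∀ x ∈ E, betaPDF (1 + a) (1 + b) x ≤ tailWeight s w (a, b) *
      (ENNReal.ofReal |s / (1 - x + s * x) ^ 2| * betaPDF (1 + a) (1 + b) (φ x)) := fun x hx => by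
    have hdx := hd x hx
    have hx0 := hx.2.1
    have hx1 : 0 < 1 - x := sub_pos.2 hx.2.2
    have h1φ : 1 - φ x = (1 - x) / (1 - x + s * x) := by
      simp only [hφ]
      field_simp
      ring
    have hφ0 : 0 < φ x := by simp only [hφ]; positivity
    have hφ1 : φ x < 1 := by
      have : 0 < 1 - φ x := by rw [h1φ]; positivity
      linarith
    rw [betaPDF_of_pos_lt_one hx0 hx.2.2, betaPDF_of_pos_lt_one hφ0 hφ1, tailWeight,
      ← ENNReal.ofReal_mul (abs_nonneg _), ← ENNReal.ofReal_mul (by positivity)]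
    apply ENNReal.ofReal_le_ofReal
    simp only [add_sub_cancel_left, Real.rpow_natCast]
    have hβ := beta_pos ha hb
    rw [h1φ, abs_of_pos (by positivity)]
    -- With `d = 1 - x + s * x` and `f` the density, `φ' * f(φ x) = s ^ (a + 1) / d ^ (a + b + 2) *
    -- f x`. On `A` one has `d ≤ w`, so the remaining factor `(w / d) ^ (a + b + 2)` is at least
    -- one.
    have e : w ^ (a + b + 2) / s ^ (a + 1) * (s / (1 - x + s * x) ^ 2 *
        (1 / beta (1 + a) (1 + b) * φ x ^ a * ((1 - x) / (1 - x + s * x)) ^ b))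
        = (w / (1 - x + s * x)) ^ (a + b + 2) *
          (1 / beta (1 + a) (1 + b) * x ^ a * (1 - x) ^ b) := by
      simp only [hφ, div_pow, mul_pow]
      field_simp
      ring
    rw [e]
    refine le_mul_of_one_le_left (by positivity) (one_le_pow₀ ?_)
    rw [one_le_div hdx]
    exact hx.1
  have hK : tailWeight s w (a, b) ≠ ⊤ := ENNReal.ofReal_ne_top
  calc betaMeasure (1 + (a : ℝ)) (1 + (b : ℝ)) A
      = ∫⁻ x in A, betaPDF (1 + a) (1 + b) x := withDensity_apply _ hAm
    _ = ∫⁻ x in E, betaPDF (1 + a) (1 + b) x := by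
        rw [← lintegral_indicator hAm, ← lintegral_indicator hEm]
        congr 1
        funext x
        by_cases h : x ∈ Set.Ioo (0 : ℝ) 1
        · by_cases h' : x ∈ A
          · rw [Set.indicator_of_mem h', Set.indicator_of_mem (s := E) ⟨h', h⟩]
          · rw [Set.indicator_of_notMem h', Set.indicator_of_notMem fun hx => h' hx.1]
        · rw [Set.indicator_of_notMem (s := E) fun hx => h hx.2]
          have : betaPDF (1 + a) (1 + b) x = 0 := by
            rcases le_or_gt x 0 with h0 | h0
            · exact betaPDF_eq_zero_of_nonpos h0
            · exact betaPDF_eq_zero_of_one_le (not_lt.1 fun h1 => h ⟨h0, h1⟩)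
          simp [Set.indicator_apply, this]
    _ ≤ ∫⁻ x in E, tailWeight s w (a, b) * (ENNReal.ofReal |s / (1 - x + s * x) ^ 2| *
          betaPDF (1 + a) (1 + b) (φ x)) := setLIntegral_mono' hEm hpt
    _ = tailWeight s w (a, b) * ∫⁻ x in φ '' E, betaPDF (1 + a) (1 + b) x := by
        rw [lintegral_const_mul' _ _ hK, lintegral_image_eq_lintegral_abs_deriv_mul hEm hφ' hinj]
    _ ≤ tailWeight s w (a, b) * 1 := by
        gcongr
        exact (setLIntegral_le_lintegral _ _).trans (lintegral_betaPDF_eq_one ha hb).le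
    _ = tailWeight s w (a, b) := mul_one _

/-- Expected one-step factor of the weight for a mean outcome `μ`. -/
lemma tilted_factor_eq (μ w : ℝ) {s : ℝ} (hs : 0 < s) :
    μ * (w / s) + (1 - μ) * w = w * (s + (1 - s) * μ) / s := by
  field_simp
  ring

/-- The expected change of the weight of the upper tail. -/
lemma upper_factor_le {μ ε : ℝ} (hμ : μ ∈ Set.Icc (0 : ℝ) 1) (hε : ε ∈ Set.Ioo (0 : ℝ) 1) :
    μ * ((1 - ε / 2 * (μ + ε)) / (1 - ε / 2)) + (1 - μ) * (1 - ε / 2 * (μ + ε))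
      ≤ 1 - ε ^ 2 / 4 := by
  obtain ⟨h0, h1⟩ := hμ
  obtain ⟨e0, e1⟩ := hε
  have hs : 0 < 1 - ε / 2 := by linarith
  rw [tilted_factor_eq _ _ hs, div_le_iff₀ hs]
  -- With `h = ε / 2`, the claim reduces to `μ * (1 - μ) ≤ 1 - h + 2 * h * μ`: the left side is at
  -- most 1/4, the right side at least 1/2.
  nlinarith [mul_nonneg (sq_nonneg ε) (sq_nonneg (μ - 1 / 2)), mul_nonneg (sq_nonneg ε) hs.le,
    mul_nonneg (mul_nonneg (sq_nonneg ε) h0) e0.le, mul_pos (mul_pos e0 e0) hs]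

/-- The expected change of the weight of the lower tail. -/
lemma lower_factor_le {μ ε : ℝ} (hμ : μ ∈ Set.Icc (0 : ℝ) 1) (hε : ε ∈ Set.Ioo (0 : ℝ) 1) :
    μ * ((1 + ε / 2 * (μ - ε)) / (1 + ε / 2)) + (1 - μ) * (1 + ε / 2 * (μ - ε))
      ≤ 1 - ε ^ 2 / 4 := by
  obtain ⟨h0, h1⟩ := hμ
  obtain ⟨e0, e1⟩ := hε
  have hs : 0 < 1 + ε / 2 := by linarith
  rw [tilted_factor_eq _ _ hs, div_le_iff₀ hs]
  -- Here the claim reduces to `μ * (1 - μ) ≤ 1 + h - 2 * h * μ`, whose right side is at least `1 -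
  -- h ≥ 1 / 2`.
  nlinarith [mul_nonneg (sq_nonneg ε) (sq_nonneg (μ - 1 / 2)), mul_nonneg (sq_nonneg ε) hs.le,
    mul_nonneg (mul_nonneg (sq_nonneg ε) (sub_nonneg.2 h1)) e0.le, mul_pos (mul_pos e0 e0) hs,
    mul_nonneg (sq_nonneg ε) (sub_nonneg.2 e1.le)]

end Tail

/-! ### Conditional laws along the trajectory -/

section Law

variable {m : ℕ}

/-- The posterior state before round `t`. -/
noncomputable def countsBefore : ℕ → (ℕ → Round m) → Counts m
  | 0, _ => 0
  | n + 1, ω => counts n (Preorder.frestrictLe (π := fun _ => Round m) n ω)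

lemma measurable_countsBefore (t : ℕ) : Measurable (countsBefore (m := m) t) := by
  cases t with
  | zero => exact measurable_const
  | succ n => exact (measurable_counts n).comp (Preorder.measurable_frestrictLe n)

open scoped Classical in
lemma countsBefore_eq (t : ℕ) (ω : ℕ → Round m) (i : Fin m) :
    countsBefore t ω i =
      (((Finset.range t).filter fun k => i ∈ (ω k).2.1 ∧ (ω k).2.2 i = true).card,
        ((Finset.range t).filter fun k => i ∈ (ω k).2.1 ∧ (ω k).2.2 i = false).card) := by
  cases t with
  | zero => rfl
  | succ n =>
    have h : ∀ (q : ℕ → Prop) [DecidablePred q], (Finset.univ.filter fun k : Finset.Iic n => q k).card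
        = ((Finset.range (n + 1)).filter q).card := by
      intro q _
      rw [Finset.card_filter, Finset.card_filter, Nat.range_succ_eq_Iic]
      exact Finset.sum_coe_sort (Finset.Iic n) fun k => if q k then 1 else 0
    exact Prod.ext (h fun k => i ∈ (ω k).2.1 ∧ (ω k).2.2 i = true)
      (h fun k => i ∈ (ω k).2.1 ∧ (ω k).2.2 i = false)

open scoped Classical in
lemma countsBefore_succ (t : ℕ) (ω : ℕ → Round m) (i : Fin m) :
    countsBefore (t + 1) ω i =
      if i ∈ (ω t).2.1 then
        if (ω t).2.2 i = true then ((countsBefore t ω i).1 + 1, (countsBefore t ω i).2)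
        else ((countsBefore t ω i).1, (countsBefore t ω i).2 + 1)
      else countsBefore t ω i := by
  rw [countsBefore_eq, countsBefore_eq, Finset.range_add_one]
  simp only [Finset.filter_insert]
  by_cases h : i ∈ (ω t).2.1 <;> by_cases h' : (ω t).2.2 i = true <;> simp [h, h']

variable {P : Problem m} {D : ProbabilityMeasure (Outcome m)}
  {oracle : (Fin m → ℝ) → Finset (Fin m)} (ho : Measurable oracle)

/-- Round 0 has no past, so the step kernels do not describe it; this supplies its law in
`lintegral_countsBefore`. -/
lemma map_frestrictLe_zero_trajMeasure {X : ℕ → Type*} [∀ n, MeasurableSpace (X n)]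
    (μ₀ : Measure (X 0)) [IsProbabilityMeasure μ₀]
    (κ : (n : ℕ) → Kernel (Π i : Finset.Iic n, X i) (X (n + 1))) [∀ n, IsMarkovKernel (κ n)] :
    (Kernel.trajMeasure μ₀ κ).map (fun x => x 0) = μ₀ := by
  have e : (fun x : Π n, X n => x 0) =
      (fun y : Π i : Finset.Iic 0, X i => y ⟨0, by simp⟩) ∘ Preorder.frestrictLe 0 := rfl
  have hev : Measurable fun y : Π i : Finset.Iic 0, X i => y ⟨0, by simp⟩ :=
    measurable_pi_apply (X := fun i : Finset.Iic 0 => X i) _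
  rw [e, ← Measure.map_map hev (Preorder.measurable_frestrictLe _),
    Kernel.trajMeasure, Measure.map_comp _ _ (Preorder.measurable_frestrictLe _),
    Kernel.traj_map_frestrictLe, Kernel.partialTraj_self, Measure.id_comp]
  have h2 := Measure.map_map (μ := μ₀)
    (g := fun y : Π i : Finset.Iic 0, X i => y ⟨0, by simp⟩)
    (f := (MeasurableEquiv.piUnique fun i : Finset.Iic 0 => X i).symm)
    hev (MeasurableEquiv.measurable _)
  exact h2.trans Measure.map_id

instance : IsProbabilityMeasure (ctsLaw P D ho) := by
  unfold ctsLaw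
  infer_instance

/-- Given the past, a round has the law determined by the posterior state before it. -/
lemma lintegral_countsBefore (t : ℕ) {g : Counts m × Round m → ℝ≥0∞} (hg : Measurable g) :
    ∫⁻ ω, g (countsBefore t ω, ω t) ∂(ctsLaw P D ho)
      = ∫⁻ ω, ∫⁻ z, g (countsBefore t ω, z) ∂(roundLaw P D ho (countsBefore t ω))
          ∂(ctsLaw P D ho) := by
  cases t with
  | zero =>
    have h := map_frestrictLe_zero_trajMeasure (X := fun _ => Round m) (roundLaw P D ho 0)
      (stepKernel P D ho)
    simp only [countsBefore, lintegral_const, measure_univ, mul_one]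
    have hg0 : Measurable fun z : Round m => g (0, z) := hg.comp measurable_prodMk_left
    have hev : Measurable fun ω : ℕ → Round m => ω 0 := measurable_pi_apply 0
    rw [← lintegral_map (f := fun z => g (0, z)) hg0 hev]
    exact congrArg (fun ν => ∫⁻ z, g (0, z) ∂ν) h
  | succ n =>
    have h := Kernel.map_frestrictLe_trajMeasure_compProd_eq_map_trajMeasure
      (X := fun _ => Round m) (μ₀ := roundLaw P D ho 0) (κ := stepKernel P D ho) (a := n)
    have hg' : Measurable fun y : ((k : Finset.Iic n) → Round m) × Round m =>
        g (counts n y.1, y.2) :=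
      hg.comp (((measurable_counts n).comp measurable_fst).prodMk measurable_snd)
    have h2 := congrArg (fun ν => ∫⁻ y, g (counts n y.1, y.2) ∂ν) h
    rw [Measure.lintegral_compProd hg', lintegral_map
      (hg'.lintegral_kernel_prod_right' (κ := stepKernel P D ho n))
      (Preorder.measurable_frestrictLe n), lintegral_map hg' (by fun_prop)] at h2
    exact h2.symm

lemma ae_posterior_isParam (c : Counts m) : ∀ᵐ θ ∂(posterior c), IsParam θ := by
  have hp : ∀ i, IsProbabilityMeasure (betaMeasure (1 + ((c i).1 : ℝ)) (1 + ((c i).2 : ℝ))) :=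
    fun i => isProbabilityMeasureBeta (by positivity) (by positivity)
  unfold IsParam posterior
  refine ae_all_iff.2 fun i => ?_
  refine (measurePreserving_eval
    (fun i => betaMeasure (1 + ((c i).1 : ℝ)) (1 + ((c i).2 : ℝ))) i).quasiMeasurePreserving.ae
    (p := fun x => x ∈ Set.Icc (0 : ℝ) 1) ?_
  rw [betaMeasure, ae_iff, withDensity_apply _ (by exact measurableSet_Icc.compl)]
  refine setLIntegral_eq_zero (by exact measurableSet_Icc.compl) fun x hx => ?_
  by_cases h : x ≤ 0
  · exact betaPDF_eq_zero_of_nonpos h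
  · refine betaPDF_eq_zero_of_one_le (not_lt.1 fun h1 => hx ⟨(not_le.1 h).le, h1.le⟩)

lemma posterior_eval_preimage (c : Counts m) (i : Fin m) {A : Set ℝ} (hA : MeasurableSet A) :
    posterior c {θ | θ i ∈ A} = betaMeasure (1 + ((c i).1 : ℝ)) (1 + ((c i).2 : ℝ)) A := by
  have hp : ∀ i, IsProbabilityMeasure (betaMeasure (1 + ((c i).1 : ℝ)) (1 + ((c i).2 : ℝ))) :=
    fun i => isProbabilityMeasureBeta (by positivity) (by positivity)
  exact (measurePreserving_eval
    (fun i => betaMeasure (1 + ((c i).1 : ℝ)) (1 + ((c i).2 : ℝ))) i).measure_preimage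
    hA.nullMeasurableSet

lemma map_fst_fst_roundLaw (c : Counts m) :
    (roundLaw P D ho c).map (fun z => z.1.1) = posterior c := by
  have : (fun z : Round m => z.1.1) = Prod.fst ∘ Prod.fst := rfl
  rw [this, ← Measure.map_map measurable_fst measurable_fst]
  change (Measure.fst (roundLaw P D ho c)).fst = _
  rw [roundLaw, Measure.fst_compProd, Measure.fst_prod]

/-- The law of the sample drawn in round `t`. -/
lemma ctsLaw_sample (t : ℕ) {A : Set (Fin m → ℝ)} (hA : MeasurableSet A) :
    ctsLaw P D ho {ω | (ω t).1.1 ∈ A} = ∫⁻ ω, posterior (countsBefore t ω) A ∂(ctsLaw P D ho) := by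
  have hA' : MeasurableSet {y : Counts m × Round m | y.2.1.1 ∈ A} :=
    hA.preimage (measurable_fst.comp (measurable_fst.comp measurable_snd))
  have h := lintegral_countsBefore (P := P) (D := D) ho t
    (g := {y : Counts m × Round m | y.2.1.1 ∈ A}.indicator 1) (measurable_one.indicator hA')
  have hm : MeasurableSet {ω : ℕ → Round m | (ω t).1.1 ∈ A} :=
    hA.preimage (measurable_fst.comp (measurable_fst.comp (measurable_pi_apply t)))
  have hm' : MeasurableSet {z : Round m | z.1.1 ∈ A} :=
    hA.preimage (measurable_fst.comp measurable_fst)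
  have e1 : ∫⁻ ω, {y : Counts m × Round m | y.2.1.1 ∈ A}.indicator 1 (countsBefore t ω, ω t)
      ∂(ctsLaw P D ho) = ctsLaw P D ho {ω | (ω t).1.1 ∈ A} := by
    rw [← lintegral_indicator_one hm]
    rfl
  rw [← e1, h]
  refine lintegral_congr fun ω => ?_
  rw [← map_fst_fst_roundLaw (P := P) (D := D) ho,
    Measure.map_apply (f := fun z : Round m => z.1.1) (measurable_fst.comp measurable_fst) hA]
  exact lintegral_indicator_one hm'

lemma lintegral_flips (x : Outcome m) (i : Fin m) (g : Bool → ℝ≥0∞) :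
    ∫⁻ y, g (y i) ∂(flips m x)
      = ENNReal.ofReal (x i) * g true + ENNReal.ofReal (1 - x i) * g false := by
  have h := (measurePreserving_eval (fun i => bernoulliMeasure true false (x i)) i).lintegral_comp
    (f := g) (Measurable.of_discrete)
  refine h.trans ?_
  rw [bernoulliMeasure_def, lintegral_add_measure, lintegral_smul_measure, lintegral_smul_measure,
    lintegral_dirac, lintegral_dirac, ENNReal.smul_def, ENNReal.smul_def, smul_eq_mul, smul_eq_mul]
  congr 2
  · rw [ENNReal.ofReal, Real.toNNReal_of_nonneg (x i).2.1]
    rfl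
  · rw [ENNReal.ofReal, Real.toNNReal_of_nonneg (sub_nonneg.2 (x i).2.2)]
    rfl

end Law

/-! ### Geometric decay of the deviation probabilities -/

section Deviation

variable {m : ℕ} {P : Problem m} {D : ProbabilityMeasure (Outcome m)}
  {oracle : (Fin m → ℝ) → Finset (Fin m)} (ho : Measurable oracle)

instance (S : Finset (Fin m)) : IsProbabilityMeasure (triggerLaw P D S) := by
  unfold triggerLaw
  infer_instance

lemma meanVec_mem_Icc (D : ProbabilityMeasure (Outcome m)) (i : Fin m) :
    meanVec D i ∈ Set.Icc (0 : ℝ) 1 := by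
  have hm : Measurable fun x : Outcome m => (x i : ℝ) :=
    measurable_subtype_coe.comp (measurable_pi_apply i)
  have hint : Integrable (fun x : Outcome m => (x i : ℝ)) (D : Measure (Outcome m)) :=
    Integrable.of_bound hm.aestronglyMeasurable 1
      (ae_of_all _ fun x => abs_le.2 ⟨by linarith [(x i).2.1], (x i).2.2⟩)
  refine ⟨integral_nonneg fun x => (x i).2.1, ?_⟩
  calc meanVec D i ≤ ∫ _, (1 : ℝ) ∂(D : Measure (Outcome m)) :=
        integral_mono hint (integrable_const _) fun x => (x i).2.2
    _ = 1 := by simp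

open scoped Classical in
/-- The factor by which the weight of arm `i` changes in a round with feedback `z`. -/
noncomputable def feedbackFactor (i : Fin m) (s w : ℝ) (z : Finset (Fin m) × (Fin m → Bool)) :
    ℝ≥0∞ :=
  if i ∈ z.1 then (if z.2 i = true then ENNReal.ofReal (w / s) else ENNReal.ofReal w) else 1

lemma tailWeight_countsBefore_succ {s w : ℝ} (hs : 0 < s) (hw : 0 < w) (t : ℕ)
    (ω : ℕ → Round m) (i : Fin m) :
    tailWeight s w (countsBefore (t + 1) ω i)
      = tailWeight s w (countsBefore t ω i) * feedbackFactor i s w (ω t).2 := by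
  rw [countsBefore_succ, feedbackFactor]
  split_ifs
  · rw [tailWeight, tailWeight, ← ENNReal.ofReal_mul (by positivity)]
    congr 1
    field_simp
    ring
  · rw [tailWeight, tailWeight, ← ENNReal.ofReal_mul (by positivity)]
    congr 1
    field_simp
    ring
  · rw [mul_one]

open scoped Classical in
/-- The expected factor of a super arm, given the tilting parameters. -/
lemma lintegral_triggerLaw_factor (hU : UnbiasedFeedback P D) {S : Finset (Fin m)}
    (hS : S ∈ P.feasible) (i : Fin m) {s w : ℝ} (hs : 0 < s) (hw : 0 < w) :
    ∫⁻ z, (if i ∈ z.2 then ENNReal.ofReal (z.1 i * (w / s) + (1 - z.1 i) * w) else 1)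
        ∂(triggerLaw P D S)
      = ENNReal.ofReal (1 - trigProb P D S i + trigProb P D S i *
          (meanVec D i * (w / s) + (1 - meanVec D i) * w)) := by
  set A : Set (Outcome m × Finset (Fin m)) := {z | i ∈ z.2} with hA
  have hAm : MeasurableSet A := (measurableSet_mem_finset i).preimage measurable_snd
  have hxm : Measurable fun z : Outcome m × Finset (Fin m) => (z.1 i : ℝ) :=
    measurable_subtype_coe.comp ((measurable_pi_apply i).comp measurable_fst)
  have hxi : Integrable (fun z : Outcome m × Finset (Fin m) => (z.1 i : ℝ)) (triggerLaw P D S) :=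
    Integrable.of_bound hxm.aestronglyMeasurable 1
      (ae_of_all _ fun z => abs_le.2 ⟨by linarith [(z.1 i).2.1], (z.1 i).2.2⟩)
  -- The factor minus one is affine in the outcome, so its integral over the triggering event
  -- involves only the integral given by unbiased feedback and the triggering probability.
  set f : Outcome m × Finset (Fin m) → ℝ := fun z => z.1 i * (w / s - w) + (w - 1) with hf
  have hfi : Integrable f (triggerLaw P D S) := (hxi.mul_const _).add (integrable_const _)
  have h1 : ∀ z : Outcome m × Finset (Fin m),
      (if i ∈ z.2 then ENNReal.ofReal (z.1 i * (w / s) + (1 - z.1 i) * w) else 1)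
        = ENNReal.ofReal (1 + A.indicator f z) := fun z => by
    by_cases h : i ∈ z.2
    · rw [if_pos h, Set.indicator_of_mem (s := A) h]
      congr 1
      simp only [hf]
      ring
    · rw [if_neg h, Set.indicator_of_notMem (s := A) h, add_zero, ENNReal.ofReal_one]
  have hnn : ∀ z, 0 ≤ 1 + A.indicator f z := fun z => by
    by_cases h : i ∈ z.2
    · rw [Set.indicator_of_mem (s := A) h]
      have : 1 + f z = z.1 i * (w / s) + (1 - z.1 i) * w := by
        simp only [hf]
        ring
      rw [this]
      exact add_nonneg (mul_nonneg (z.1 i).2.1 (by positivity))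
        (mul_nonneg (sub_nonneg.2 (z.1 i).2.2) hw.le)
    · rw [Set.indicator_of_notMem (s := A) h, add_zero]
      exact zero_le_one
  have hind : Integrable (A.indicator f) (triggerLaw P D S) := hfi.indicator hAm
  have hsum : Integrable (fun z => 1 + A.indicator f z) (triggerLaw P D S) :=
    (integrable_const _).add hind
  simp only [h1]
  rw [← ofReal_integral_eq_lintegral_ofReal hsum (ae_of_all _ hnn),
    integral_add (integrable_const _) hind, integral_indicator hAm]
  simp only [hf]
  rw [integral_add (hxi.mul_const _).integrableOn (integrable_const _), integral_mul_const,
    hU S hS i]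
  simp only [integral_const, probReal_univ, smul_eq_mul, measureReal_restrict_apply_univ]
  change ENNReal.ofReal (1 * 1 + (trigProb P D S i * meanVec D i * (w / s - w)
    + trigProb P D S i * (w - 1))) = _
  congr 1
  ring

lemma measurable_feedbackFactor (i : Fin m) (s w : ℝ) : Measurable (feedbackFactor i s w) := by
  classical
  refine Measurable.ite ((measurableSet_mem_finset i).preimage measurable_fst)
    (Measurable.ite ((measurableSet_singleton true).preimage
      ((measurable_pi_apply i).comp measurable_snd)) measurable_const measurable_const)
    measurable_const

/-- Conditionally on the sample, arm `i` is triggered with some probability `q ≥ p`, and the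
expected factor is at most `1 - q * κ ≤ 1 - p * κ`. The bound is uniform in the state `c`, so it can
be iterated. -/
lemma lintegral_roundLaw_feedbackFactor_le (hU : UnbiasedFeedback P D)
    (hfeas : ∀ θ, IsParam θ → oracle θ ∈ P.feasible) (i : Fin m) {s w κ p : ℝ} (hs : 0 < s)
    (hw : 0 < w) (hκ : 0 ≤ κ) (hp : ∀ S ∈ P.feasible, p ≤ trigProb P D S i)
    (hfac : meanVec D i * (w / s) + (1 - meanVec D i) * w ≤ 1 - κ) (c : Counts m) :
    ∫⁻ z, feedbackFactor i s w z.2 ∂(roundLaw P D ho c) ≤ ENNReal.ofReal (1 - p * κ) := by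
  classical
  have hgm := measurable_feedbackFactor i s w
  have hg2 : Measurable fun z : Round m => feedbackFactor i s w z.2 := hgm.comp measurable_snd
  rw [roundLaw, Measure.lintegral_compProd hg2]
  have hin : ∀ y : (Fin m → ℝ) × Outcome m,
      ∫⁻ v, feedbackFactor i s w v ∂(((P.trig.comap
        (fun z : (Fin m → ℝ) × Outcome m => (oracle z.1, z.2))
        ((ho.comp measurable_fst).prodMk measurable_snd)) ×ₖ
      ((flips m).comap Prod.snd measurable_snd)) y)
      = ∫⁻ S', (if i ∈ S' then ENNReal.ofReal (y.2 i * (w / s) + (1 - y.2 i) * w) else 1)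
          ∂(P.trig (oracle y.1, y.2)) := fun y => by
    rw [Kernel.lintegral_prod _ _ _ hgm, Kernel.comap_apply, Kernel.comap_apply]
    refine lintegral_congr fun S' => ?_
    by_cases h : i ∈ S'
    · simp only [feedbackFactor, if_pos h]
      have h2 := lintegral_flips y.2 i
        fun b => if b = true then ENNReal.ofReal (w / s) else ENNReal.ofReal w
      refine h2.trans ?_
      have hx0 := (y.2 i).2.1
      have hx1 := sub_nonneg.2 (y.2 i).2.2
      simp only [if_true, Bool.false_eq_true, if_false]
      rw [← ENNReal.ofReal_mul hx0, ← ENNReal.ofReal_mul hx1, ← ENNReal.ofReal_add]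
      · exact mul_nonneg hx0 (by positivity)
      · exact mul_nonneg hx1 hw.le
    · simp [feedbackFactor, h]
  have hm1 : Measurable fun y : (Fin m → ℝ) × Outcome m => ∫⁻ v, feedbackFactor i s w v
      ∂(((P.trig.comap (fun z : (Fin m → ℝ) × Outcome m => (oracle z.1, z.2))
        ((ho.comp measurable_fst).prodMk measurable_snd)) ×ₖ
      ((flips m).comap Prod.snd measurable_snd)) y) := hgm.lintegral_kernel
  rw [MeasureTheory.lintegral_prod _ hm1.aemeasurable]
  calc _ ≤ ∫⁻ _, ENNReal.ofReal (1 - p * κ) ∂(posterior c) := by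
        -- Feasibility of the selected super arm is known only for samples in the unit cube, which
        -- has full posterior measure.
        refine lintegral_mono_ae ?_
        filter_upwards [ae_posterior_isParam c] with θ hθ
        have hS := hfeas θ hθ
        have hm2 : Measurable fun z : Outcome m × Finset (Fin m) =>
            (if i ∈ z.2 then ENNReal.ofReal (z.1 i * (w / s) + (1 - z.1 i) * w) else 1) := by
          have hxm : Measurable fun z : Outcome m × Finset (Fin m) => (z.1 i : ℝ) :=
            measurable_subtype_coe.comp ((measurable_pi_apply i).comp measurable_fst)
          exact Measurable.ite ((measurableSet_mem_finset i).preimage measurable_snd)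
            (by fun_prop) measurable_const
        simp only [hin]
        have h3 := lintegral_triggerLaw_factor hU hS i hs hw
        rw [triggerLaw, Measure.lintegral_compProd hm2] at h3
        simp only [Kernel.sectR_apply] at h3
        rw [h3]
        apply ENNReal.ofReal_le_ofReal
        have hq := hp _ hS
        have hq0 : 0 ≤ trigProb P D (oracle θ) i := measureReal_nonneg
        nlinarith [mul_le_mul_of_nonneg_left hfac hq0, mul_le_mul_of_nonneg_right hq hκ]
    _ = ENNReal.ofReal (1 - p * κ) := by simp

/-- The expected weight decreases geometrically. -/
lemma lintegral_tailWeight_le (hU : UnbiasedFeedback P D)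
    (hfeas : ∀ θ, IsParam θ → oracle θ ∈ P.feasible) (i : Fin m) {s w κ p : ℝ} (hs : 0 < s)
    (hw : 0 < w) (hκ : 0 ≤ κ) (hp : ∀ S ∈ P.feasible, p ≤ trigProb P D S i)
    (hfac : meanVec D i * (w / s) + (1 - meanVec D i) * w ≤ 1 - κ) (t : ℕ) :
    ∫⁻ ω, tailWeight s w (countsBefore t ω i) ∂(ctsLaw P D ho)
      ≤ ENNReal.ofReal (1 - p * κ) ^ t * ENNReal.ofReal (w ^ 2 / s) := by
  induction t with
  | zero => simp [countsBefore, tailWeight]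
  | succ t ih =>
    have hg : Measurable fun y : Counts m × Round m =>
        tailWeight s w (y.1 i) * feedbackFactor i s w y.2.2 :=
      ((Measurable.of_discrete (f := fun c : Counts m => tailWeight s w (c i))).comp
        measurable_fst).mul ((measurable_feedbackFactor i s w).comp
          (measurable_snd.comp measurable_snd))
    simp only [tailWeight_countsBefore_succ hs hw]
    rw [lintegral_countsBefore (P := P) (D := D) ho t hg]
    simp only
    have hm2 : Measurable fun z : Round m => feedbackFactor i s w z.2 :=
      (measurable_feedbackFactor i s w).comp measurable_snd
    calc _ ≤ ∫⁻ ω, ENNReal.ofReal (1 - p * κ) * tailWeight s w (countsBefore t ω i)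
          ∂(ctsLaw P D ho) := by
          refine lintegral_mono fun ω => ?_
          rw [lintegral_const_mul _ hm2, mul_comm]
          gcongr
          exact lintegral_roundLaw_feedbackFactor_le ho hU hfeas i hs hw hκ hp hfac _
      _ ≤ ENNReal.ofReal (1 - p * κ) *
            (ENNReal.ofReal (1 - p * κ) ^ t * ENNReal.ofReal (w ^ 2 / s)) := by
          rw [lintegral_const_mul' _ _ ENNReal.ofReal_ne_top]
          gcongr
      _ = _ := by rw [pow_succ']; ring

lemma trigProb_le_one (S : Finset (Fin m)) (i : Fin m) : trigProb P D S i ≤ 1 :=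
  measureReal_le_one

/-- The probability that the sample of arm `i` deviates from its mean decreases geometrically. -/
lemma ctsLaw_deviation_le (hU : UnbiasedFeedback P D)
    (hfeas : ∀ θ, IsParam θ → oracle θ ∈ P.feasible) (i : Fin m) {ε p : ℝ}
    (hε : ε ∈ Set.Ioo (0 : ℝ) 1) (hp : ∀ S ∈ P.feasible, p ≤ trigProb P D S i)
    (t : ℕ) :
    (ctsLaw P D ho).real {ω | ε < |(ω t).1.1 i - meanVec D i|}
      ≤ 4 * (1 - p * (ε ^ 2 / 4)) ^ t := by
  obtain ⟨e0, e1⟩ := hε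
  have hμ := meanVec_mem_Icc D i
  obtain ⟨h0, h1⟩ := hμ
  have hp1 : p ≤ 1 := by
    obtain ⟨S, hS⟩ := P.feasible_nonempty
    exact (hp S hS).trans (trigProb_le_one S i)
  have hκ : (0 : ℝ) ≤ ε ^ 2 / 4 := by positivity
  have hr : 0 ≤ 1 - p * (ε ^ 2 / 4) := by nlinarith
  have main : ∀ s w : ℝ, 0 < s → 0 < w → w ^ 2 / s ≤ 2 →
      meanVec D i * (w / s) + (1 - meanVec D i) * w ≤ 1 - ε ^ 2 / 4 →
      (ctsLaw P D ho).real {ω | 1 - (ω t).1.1 i + s * (ω t).1.1 i ≤ w}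
        ≤ 2 * (1 - p * (ε ^ 2 / 4)) ^ t := by
    intro s w hs hw hws hfac
    have hA : MeasurableSet {x : ℝ | 1 - x + s * x ≤ w} :=
      measurableSet_le (by fun_prop) (by fun_prop)
    refine ENNReal.toReal_le_of_le_ofReal (by positivity) ?_
    have h := ctsLaw_sample (P := P) (D := D) ho t (hA.preimage (measurable_pi_apply i))
    refine h.trans_le ?_
    calc _ ≤ ∫⁻ ω, tailWeight s w (countsBefore t ω i) ∂(ctsLaw P D ho) := by
          refine lintegral_mono fun ω => ?_
          exact (posterior_eval_preimage _ i hA).trans_le (betaMeasure_tail_le hs hw _ _)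
      _ ≤ _ := lintegral_tailWeight_le ho hU hfeas i hs hw hκ hp hfac t
      _ ≤ _ := by
          rw [← ENNReal.ofReal_pow hr, ← ENNReal.ofReal_mul (by positivity)]
          apply ENNReal.ofReal_le_ofReal
          rw [mul_comm]
          gcongr
  -- The tilts `s = 1 ∓ ε / 2` turn the two half-lines `x ≥ μ + ε` and `x ≤ μ - ε` into events `1 -
  -- x + s * x ≤ w`.
  have hsub : {ω : ℕ → Round m | ε < |(ω t).1.1 i - meanVec D i|} ⊆
      {ω | 1 - (ω t).1.1 i + (1 - ε / 2) * (ω t).1.1 i ≤ 1 - ε / 2 * (meanVec D i + ε)} ∪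
      {ω | 1 - (ω t).1.1 i + (1 + ε / 2) * (ω t).1.1 i ≤ 1 + ε / 2 * (meanVec D i - ε)} := by
    intro ω hω
    rcases lt_abs.1 hω.out with h | h
    · left
      simp only [Set.mem_ofPred_eq]
      nlinarith
    · right
      simp only [Set.mem_ofPred_eq]
      nlinarith
  have hup := main (1 - ε / 2) (1 - ε / 2 * (meanVec D i + ε)) (by linarith) (by nlinarith)
    (by
      -- The initial weight is at most 2 because `w ≤ 1` and `s ≥ 1 / 2`; in the lower tail below,
      -- because `w ≤ s ≤ 3 / 2`.
      rw [div_le_iff₀ (by linarith)]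
      have a1 : 0 ≤ 1 - ε / 2 * (meanVec D i + ε) := by nlinarith
      have a2 : 1 - ε / 2 * (meanVec D i + ε) ≤ 1 := by nlinarith
      nlinarith) (upper_factor_le ⟨h0, h1⟩ ⟨e0, e1⟩)
  have hlo := main (1 + ε / 2) (1 + ε / 2 * (meanVec D i - ε)) (by linarith) (by nlinarith)
    (by
      rw [div_le_iff₀ (by linarith)]
      have a1 : 0 ≤ 1 + ε / 2 * (meanVec D i - ε) := by nlinarith
      have a2 : 1 + ε / 2 * (meanVec D i - ε) ≤ 1 + ε / 2 := by nlinarith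
      nlinarith) (lower_factor_le ⟨h0, h1⟩ ⟨e0, e1⟩)
  calc _ ≤ _ := measureReal_mono hsub
    _ ≤ _ := measureReal_union_le _ _
    _ ≤ _ := by linarith

end Deviation

/-! ### From deviations to regret -/

section Regret

variable {m : ℕ} {P : Problem m} {D : ProbabilityMeasure (Outcome m)}
  {r : Finset (Fin m) → (Fin m → ℝ) → ℝ} {oracle : (Fin m → ℝ) → Finset (Fin m)}

lemma mem_feasible_of_mem_opt {θ : Fin m → ℝ} {S : Finset (Fin m)} (h : S ∈ opt P r θ) :
    S ∈ P.feasible := by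
  classical
  exact (Finset.mem_filter.1 h).1

lemma le_of_mem_opt {θ : Fin m → ℝ} {S S' : Finset (Fin m)} (h : S ∈ opt P r θ)
    (h' : S' ∈ P.feasible) : r S' θ ≤ r S θ := by
  classical
  exact (Finset.mem_filter.1 h).2 S' h'

lemma trigSet_eq_univ {p : ℝ} (hp0 : 0 < p)
    {S : Finset (Fin m)} (hp : ∀ i, p ≤ trigProb P D S i) : trigSet P D S = Finset.univ := by
  classical
  exact Finset.filter_true_of_mem fun i _ => hp0.trans_le (hp i)

lemma gap_nonneg {Sstar S : Finset (Fin m)} (hs : Sstar ∈ opt P r (meanVec D))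
    (hS : S ∈ P.feasible) : 0 ≤ gap D r Sstar S :=
  sub_nonneg.2 (le_of_mem_opt hs hS)

lemma gap_le_gapMax (Sstar : Finset (Fin m)) {S : Finset (Fin m)} (hS : S ∈ P.feasible) :
    gap D r Sstar S ≤ gapMax P D r Sstar :=
  Finset.le_sup' (fun S => gap D r Sstar S) hS

lemma gapMax_nonneg {Sstar : Finset (Fin m)} (hs : Sstar ∈ opt P r (meanVec D)) :
    0 ≤ gapMax P D r Sstar :=
  (gap_nonneg hs (mem_feasible_of_mem_opt hs)).trans
    (gap_le_gapMax Sstar (mem_feasible_of_mem_opt hs))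

lemma gap_eq_zero_of_notMem_subopt {Sstar S : Finset (Fin m)}
    (hs : Sstar ∈ opt P r (meanVec D)) (hS : S ∈ P.feasible) (h : S ∉ subopt P D r) :
    gap D r Sstar S = 0 := by
  have hSo : S ∈ opt P r (meanVec D) := by
    by_contra h'
    exact h (Finset.mem_sdiff.2 ⟨hS, h'⟩)
  exact sub_eq_zero.2 (le_antisymm (le_of_mem_opt hSo (mem_feasible_of_mem_opt hs))
    (le_of_mem_opt hs hS))

/-- A super arm that is optimal for a parameter vector close to the mean vector has a small gap. -/
lemma gap_le_of_forall_abs_sub_le {B ε : ℝ} (hB : 0 < B) (hL : LipschitzReward P D r B)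
    {θ : Fin m → ℝ} (hθ : IsParam θ) {Sstar S : Finset (Fin m)}
    (hs : Sstar ∈ P.feasible) (hS : S ∈ opt P r θ) (h : ∀ i, |θ i - meanVec D i| ≤ ε) :
    gap D r Sstar S ≤ 2 * B * m * ε := by
  have hμ : IsParam (meanVec D) := meanVec_mem_Icc D
  have key : ∀ S' ∈ P.feasible, |r S' θ - r S' (meanVec D)| ≤ B * (m * ε) := fun S' hS' => by
    refine (hL S' hS' θ _ hθ hμ).trans ?_
    gcongr
    -- Enlarging the sum to all arms makes the bound the same for every super arm.
    calc _ ≤ ∑ i : Fin m, |θ i - meanVec D i| :=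
          Finset.sum_le_univ_sum_of_nonneg fun i => abs_nonneg _
      _ ≤ ∑ _i : Fin m, ε := Finset.sum_le_sum fun i _ => h i
      _ = m * ε := by simp
  have h1 := abs_le.1 (key Sstar hs)
  have h2 := abs_le.1 (key S (mem_feasible_of_mem_opt hS))
  have h3 := le_of_mem_opt hS hs
  unfold gap
  linarith [h1.1, h2.2]

/-- If deviations of the samples by more than `ε` are needed for playing a suboptimal super arm,
then the regret is at most the maximum gap times the expected number of deviations. -/
lemma regret_le_sum_deviation (ho : IsOracle P r oracle) {B ε : ℝ} (hB : 0 < B)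
    (hL : LipschitzReward P D r B) {Sstar : Finset (Fin m)}
    (hs : Sstar ∈ opt P r (meanVec D))
    (hgap : ∀ S ∈ subopt P D r, 2 * B * m * ε < gap D r Sstar S) (T : ℕ) :
    regret P D r ho.measurable Sstar T ≤ gapMax P D r Sstar *
      ∑ t ∈ Finset.range T, ∑ i, (ctsLaw P D ho.measurable).real
        {ω | ε < |(ω t).1.1 i - meanVec D i|} := by
  set A : ℕ → Fin m → Set (ℕ → Round m) := fun t i => {ω | ε < |(ω t).1.1 i - meanVec D i|}
  have hθm : ∀ t, Measurable fun ω : ℕ → Round m => (ω t).1.1 := fun t =>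
    measurable_fst.comp (measurable_fst.comp (measurable_pi_apply t))
  have hA : ∀ t i, MeasurableSet (A t i) := fun t i => by
    have : Measurable fun ω : ℕ → Round m => (ω t).1.1 i := (measurable_pi_apply i).comp (hθm t)
    exact measurableSet_lt measurable_const (by fun_prop)
  have hparam : ∀ᵐ ω ∂(ctsLaw P D ho.measurable), ∀ t, IsParam (ω t).1.1 := by
    refine ae_all_iff.2 fun t => ?_
    have hm : MeasurableSet {θ : Fin m → ℝ | ¬ IsParam θ} := by
      refine MeasurableSet.compl (s := {θ : Fin m → ℝ | IsParam θ}) ?_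
      have : {θ : Fin m → ℝ | IsParam θ} = Set.univ.pi fun _ => Set.Icc (0 : ℝ) 1 := by
        ext θ
        exact Set.mem_univ_pi.symm
      rw [this]
      exact MeasurableSet.univ_pi fun _ => measurableSet_Icc
    refine (ctsLaw_sample ho.measurable t hm).trans ?_
    exact (lintegral_congr fun ω => ae_iff.1 (ae_posterior_isParam _)).trans lintegral_zero
  have hind : ∀ t i, Integrable ((A t i).indicator (1 : (ℕ → Round m) → ℝ))
      (ctsLaw P D ho.measurable) := fun t i => (integrable_const (1 : ℝ)).indicator (hA t i)
  have hsum : Integrable (fun ω => ∑ t ∈ Finset.range T, ∑ i, (A t i).indicator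
      (1 : (ℕ → Round m) → ℝ) ω) (ctsLaw P D ho.measurable) :=
    integrable_finsetSum _ fun t _ => integrable_finsetSum _ fun i _ => hind t i
  have hfeas : ∀ θ, IsParam θ → oracle θ ∈ P.feasible := fun θ hθ =>
    mem_feasible_of_mem_opt (ho.mem_opt θ hθ)
  calc regret P D r ho.measurable Sstar T
      ≤ ∫ ω, gapMax P D r Sstar * ∑ t ∈ Finset.range T, ∑ i, (A t i).indicator
          (1 : (ℕ → Round m) → ℝ) ω ∂(ctsLaw P D ho.measurable) := by
        -- Almost sure nonnegativity of the regret replaces a proof of its integrability.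
        refine integral_mono_of_nonneg ?_ (hsum.const_mul _) ?_
        · filter_upwards [hparam] with ω hω
          exact Finset.sum_nonneg fun t _ => gap_nonneg hs (hfeas _ (hω t))
        · filter_upwards [hparam] with ω hω
          rw [Finset.mul_sum]
          refine Finset.sum_le_sum fun t _ => ?_
          change gap D r Sstar (oracle (ω t).1.1) ≤ _
          have hnn : ∀ i, 0 ≤ (A t i).indicator (1 : (ℕ → Round m) → ℝ) ω := fun i =>
            Set.indicator_nonneg (fun _ _ => zero_le_one) _
          have hM := gapMax_nonneg (P := P) hs
          by_cases hall : ∀ i, |(ω t).1.1 i - meanVec D i| ≤ ε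
          · have h1 := gap_le_of_forall_abs_sub_le hB hL (hω t) (mem_feasible_of_mem_opt hs)
              (ho.mem_opt _ (hω t)) hall
            rw [gap_eq_zero_of_notMem_subopt hs (hfeas _ (hω t))
              fun h => absurd (hgap _ h) (not_lt.2 h1)]
            exact mul_nonneg hM (Finset.sum_nonneg fun i _ => hnn i)
          · obtain ⟨i, hi⟩ := not_forall.1 hall
            have hmem : ω ∈ A t i := not_le.1 hi
            refine (gap_le_gapMax Sstar (hfeas _ (hω t))).trans (le_mul_of_one_le_right hM ?_)
            calc (1 : ℝ) = (A t i).indicator (1 : (ℕ → Round m) → ℝ) ω := by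
                  rw [Set.indicator_of_mem hmem, Pi.one_apply]
              _ ≤ _ := Finset.single_le_sum (f := fun i => (A t i).indicator
                  (1 : (ℕ → Round m) → ℝ) ω) (fun i _ => hnn i) (Finset.mem_univ i)
    _ = _ := by
        rw [integral_const_mul, integral_finsetSum _
          fun t _ => integrable_finsetSum _ fun i _ => hind t i]
        congr 1
        refine Finset.sum_congr rfl fun t _ => ?_
        rw [integral_finsetSum _ fun i _ => hind t i]
        exact Finset.sum_congr rfl fun i _ => integral_indicator_one (hA t i)

/-- When every super arm triggers every arm with probability at least `p`, the regret is bounded by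
a multiple of the maximum gap. -/
lemma regret_le_mul_gapMax (hU : UnbiasedFeedback P D) (ho : IsOracle P r oracle) {B ε p : ℝ}
    (hB : 0 < B) (hL : LipschitzReward P D r B) (hε : ε ∈ Set.Ioo (0 : ℝ) 1)
    {Sstar : Finset (Fin m)} (hs : Sstar ∈ opt P r (meanVec D)) (hp0 : 0 < p)
    (hp : ∀ i : Fin m, ∀ S ∈ P.feasible, p ≤ trigProb P D S i)
    (hgap : ∀ S ∈ subopt P D r, 2 * B * m * ε < gap D r Sstar S) (T : ℕ) :
    regret P D r ho.measurable Sstar T ≤ 16 * m / (p * ε ^ 2) * gapMax P D r Sstar := by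
  obtain ⟨e0, e1⟩ := hε
  have hdev : ∀ i : Fin m, ∑ t ∈ Finset.range T, (ctsLaw P D ho.measurable).real
      {ω | ε < |(ω t).1.1 i - meanVec D i|} ≤ 16 / (p * ε ^ 2) := fun i => by
    have hp1 : p ≤ 1 := (hp i Sstar (mem_feasible_of_mem_opt hs)).trans (trigProb_le_one _ i)
    have hx : 0 < p * (ε ^ 2 / 4) := by positivity
    have hx1 : 0 ≤ 1 - p * (ε ^ 2 / 4) := by nlinarith
    calc _ ≤ ∑ t ∈ Finset.range T, 4 * (1 - p * (ε ^ 2 / 4)) ^ t :=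
          Finset.sum_le_sum fun t _ => ctsLaw_deviation_le ho.measurable hU
            (fun θ hθ => mem_feasible_of_mem_opt (ho.mem_opt θ hθ)) i ⟨e0, e1⟩ (hp i) t
      _ ≤ 4 * (1 - (1 - p * (ε ^ 2 / 4)))⁻¹ := by
          rw [← Finset.mul_sum]
          gcongr
          -- Comparison with the full series removes the dependence on `T`.
          rw [← tsum_geometric_of_lt_one hx1 (by linarith)]
          exact (summable_geometric_of_lt_one hx1 (by linarith)).sum_le_tsum _
            fun t _ => pow_nonneg hx1 t
      _ = 16 / (p * ε ^ 2) := by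
          field_simp
          ring
  calc _ ≤ _ := regret_le_sum_deviation ho hB hL hs hgap T
    _ ≤ gapMax P D r Sstar * ∑ _i : Fin m, 16 / (p * ε ^ 2) := by
        rw [Finset.sum_comm]
        exact mul_le_mul_of_nonneg_left (Finset.sum_le_sum fun i _ => hdev i) (gapMax_nonneg hs)
    _ = _ := by
        rw [Finset.sum_const, Finset.card_univ, Fintype.card_fin, nsmul_eq_mul]
        ring

end Regret

end CMAB

/-! ### Comparison with the stated bound -/

open CMAB in
theorem theorem4 :
    ∃ α : ℝ, 0 < α ∧
      ∀ (m : ℕ) (P : Problem m) (r : Finset (Fin m) → (Fin m → ℝ) → ℝ)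
        (D : ProbabilityMeasure (Outcome m)),
        D ∈ P.distClass →
        IndependentOutcomes D →
        UnbiasedFeedback P D →
        IsExpectedReward P r →
        ∀ B : ℝ, 0 < B → LipschitzReward P D r B →
        ∀ (oracle : (Fin m → ℝ) → Finset (Fin m)) (ho : IsOracle P r oracle)
          (Sstar : Finset (Fin m)), IsMinimalOpt P D r Sstar →
        ∀ p : ℝ, 0 < p → (∀ i : Fin m, ∀ S ∈ P.feasible, p ≤ trigProb P D S i) →
        ∀ ρ ∈ Set.Ioo (0 : ℝ) 1,
        ∀ ε ∈ Set.Ioc (0 : ℝ) (1 / Real.sqrt (Real.exp 1)),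
        ∀ k : ℕ, k = (trigSet P D Sstar).card →
        (∀ S ∈ subopt P D r, 2 * B * ((k : ℝ) ^ 2 + 2) * ε < gap D r Sstar S) →
        ∀ T : ℕ,
          regret P D r ho.measurable Sstar T ≤
            -- the maximum of the first argument and of the values at all suboptimal super arms
            (subopt P D r).fold max (16 * m * B * Real.sqrt (Real.exp 1 / ((1 - ρ) * p)))
              (fun S =>
                128 * m * B ^ 2 * (trigSet P D S).card /
                    ((1 - ρ) * p * (gap D r Sstar S - 2 * B * ((k : ℝ) ^ 2 + 2) * ε)) *
                  Real.log (4 * B * (trigSet P D S).card /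
                    ((1 - ρ) * p * (gap D r Sstar S - 2 * B * ((k : ℝ) ^ 2 + 2) * ε))))
            + (5 + (maxTrigSize P D : ℝ) ^ 2 / ((1 - ρ) * p * ε ^ 2)
                + 2 * (if p < 1 then 1 else 0) / (ρ ^ 2 * p)) * m * gapMax P D r Sstar
            + α * (8 * k / (p * ε ^ 2)) * (4 / ε ^ 2 + 1) ^ k * Real.log (k / ε ^ 2)
                * gapMax P D r Sstar := by
  -- The value 2 is chosen so that `2 * 8` matches the constant 16 of `regret_le_mul_gapMax`.
  refine ⟨2, two_pos, ?_⟩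
  intro m P r D _ _ hU _ B hB hL oracle ho Sstar hs p hp0 hp ρ hρ ε hε k hk hgap T
  obtain ⟨e0, hεe⟩ := hε
  have hexp : ε ^ 2 * Real.exp 1 ≤ 1 := by
    have h := Real.sqrt_pos.2 (Real.exp_pos 1)
    rw [le_div_iff₀ h] at hεe
    calc ε ^ 2 * Real.exp 1 = (ε * Real.sqrt (Real.exp 1)) ^ 2 := by
          rw [mul_pow, Real.sq_sqrt (Real.exp_pos 1).le]
      _ ≤ 1 := pow_le_one₀ (by positivity) hεe
  have e1 : ε < 1 := by
    have := Real.add_one_lt_exp (one_ne_zero (α := ℝ))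
    by_contra h
    nlinarith [mul_le_mul (not_lt.1 h) (not_lt.1 h) zero_le_one e0.le]
  have hkm : k = m := by
    rw [hk, trigSet_eq_univ hp0 fun i => hp i Sstar (mem_feasible_of_mem_opt hs.1),
      Finset.card_univ, Fintype.card_fin]
  subst hkm
  have hM := gapMax_nonneg (P := P) hs.1
  have hgap' : ∀ S ∈ subopt P D r, 2 * B * k * ε < gap D r Sstar S := fun S hS => by
    refine lt_of_le_of_lt ?_ (hgap S hS)
    have : (k : ℝ) ≤ (k : ℝ) ^ 2 + 2 := by nlinarith [sq_nonneg ((k : ℝ) - 1)]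
    gcongr
  have hmain := regret_le_mul_gapMax hU ho hB hL ⟨e0, e1⟩ hs.1 hp0 hp hgap' T
  -- The values at suboptimal arms may have either sign because of the logarithm; the nonnegative
  -- starting value of the fold suffices.
  have h1 := Finset.le_fold_max (s := subopt P D r)
    (b := 16 * k * B * Real.sqrt (Real.exp 1 / ((1 - ρ) * p)))
    (f := fun S => 128 * k * B ^ 2 * (trigSet P D S).card /
      ((1 - ρ) * p * (gap D r Sstar S - 2 * B * ((k : ℝ) ^ 2 + 2) * ε)) *
        Real.log (4 * B * (trigSet P D S).card /
          ((1 - ρ) * p * (gap D r Sstar S - 2 * B * ((k : ℝ) ^ 2 + 2) * ε)))) (0 : ℝ) |>.2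
    (Or.inl (by positivity))
  have hρ' : 0 < 1 - ρ := sub_pos.2 hρ.2
  have h2 : 0 ≤ (5 + (maxTrigSize P D : ℝ) ^ 2 / ((1 - ρ) * p * ε ^ 2)
      + 2 * (if p < 1 then 1 else 0) / (ρ ^ 2 * p)) * k * gapMax P D r Sstar := by
    have := hρ.1
    split_ifs <;> positivity
  have h3 : 16 * k / (p * ε ^ 2) ≤
      2 * (8 * k / (p * ε ^ 2)) * (4 / ε ^ 2 + 1) ^ k * Real.log (k / ε ^ 2) := by
    rcases Nat.eq_zero_or_pos k with rfl | hk0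
    · simp
    · have hk1 : (1 : ℝ) ≤ k := by exact_mod_cast hk0
      -- This is where `ε ≤ 1 / √e` enters: `e * ε ^ 2 ≤ 1 ≤ k`.
      have hlog : 1 ≤ Real.log (k / ε ^ 2) := by
        rw [Real.le_log_iff_exp_le (by positivity), le_div_iff₀ (by positivity)]
        linarith
      have hpow : 1 ≤ (4 / ε ^ 2 + 1) ^ k := one_le_pow₀ (by
        have : 0 ≤ 4 / ε ^ 2 := by positivity
        linarith)
      calc 16 * k / (p * ε ^ 2) = 2 * (8 * k / (p * ε ^ 2)) * 1 * 1 := by ring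
        _ ≤ _ := by gcongr
  have h4 := mul_le_mul_of_nonneg_right h3 hM
  linarith
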